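/- Let ${\sf X}={\sf X}_{\sf u}\times{\sf X}_{\sf n}$ be a finite set, with elements written $x=(x_u,x_n)$, and let ${\mathcal U}\colon{\sf X}\to\mathbb R$. Let $R_0(x,x_u')$ and $Q_0(x,x_n')$ be transition kernels (for each $x\in{\sf X}$, probability mass functions on ${\sf X}_{\sf u}$ and on ${\sf X}_{\sf n}$ respectively) such that the nominal transition matrix $P_0(x,x')=R_0(x,x_u')\,Q_0(x,x_n')$ on ${\sf X}$ is irreducible and aperiodic. A randomized decision rule is a kernel $R(x,x_u')$ (a pmf on ${\sf X}_{\sf u}$ for each $x\in{\sf X}$); its transition matrix is $P(x,x')=R(x,x_u')\,Q_0(x,x_n')$, and for $\zeta\in\mathbb R$ the one-step reward is $$w(x,R)=\zeta\,{\mathcal U}(x)-\sum_{x'}P(x,x')\log\frac{P(x,x')}{P_0(x,x')},$$ with $0\log 0=0$, and with $w(x,R)=-\infty$ if $P(x,\cdot)$ is not absolutely continuous with respect to $P_0(x,\cdot)$. Fix a state $x^\circ\in{\sf X}$. Then there exist, for all $\zeta\in\mathbb R$, a pmf $\check\pi_\zeta$ on ${\sf X}$, a transition matrix $\check P_\zeta$,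 a function $h^*_\zeta\colon{\sf X}\to\mathbb R$ with $h^*_\zeta(x^\circ)=0$ and a number $\eta^*(\zeta)\in\mathbb R$ such that, for every $\zeta\in\mathbb R$: (a) $(\check\pi_\zeta,\check P_\zeta)$ maximizes $$\zeta\sum_x\pi(x){\mathcal U}(x)-K(P\|P_0),\qquad K(P\|P_0)=\sum_{x,x'}\pi(x)P(x,x')\log\frac{P(x,x')}{P_0(x,x')},$$ over all pairs $(\pi,P)$ such that $P(x,x')=R(x,x_u')Q_0(x,x_n')$ for some randomized decision rule $R$ and $\pi$ is a pmf on ${\sf X}$ with $\pi P=\pi$; the maximal value is $\eta^*(\zeta)$. (b) $(h^*_\zeta,\eta^*(\zeta))$ solves the average-reward optimality equation (AROE) $$\max_R\Bigl\{w(x,R)+\sum_{x'}P(x,x')h^*_\zeta(x')\Bigr\}=h^*_\zeta(x)+\eta^*(\zeta),\qquad x\in{\sf X},$$ where $P$ is the transition matrix of $R$. For every initial state $x$, $\eta^*(\zeta)$ is the maximal average reward $\max\,\liminf_{T\to\infty}\frac1T\sum_{t=0}^{T-1}{\sf E}_x[w(X(t),R(t))]$ over all sequences $R(0),R(1),\dots$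 of randomized decision rules, where $R(t)$ may depend on $X(0),\dots,X(t)$. Moreover $\check P_\zeta$ is the transition matrix of a randomized decision rule which attains the maximum in the AROE at every $x$, and whose constant use $R(t)\equiv R$ attains the maximal average reward from every initial state. (i) For all $x,x'\in{\sf X}$, $$\check P_\zeta(x,x')=P_0(x,x')\exp\bigl(h_\zeta(x_u'\mid x)-\Lambda_{h_\zeta}(x)\bigr),$$ where $h_\zeta(x_u'\mid x)=\sum_{x_n'}Q_0(x,x_n')\,h^*_\zeta(x_u',x_n')$ and $\Lambda_{h_\zeta}(x)=\log\Bigl(\sum_{x'}P_0(x,x')\exp\bigl(h_\zeta(x_u'\mid x)\bigr)\Bigr)$. (ii) The functions $\zeta\mapsto\check\pi_\zeta(x)$, $\zeta\mapsto\check P_\zeta(x,x')$, $\zeta\mapsto h^*_\zeta(x)$ and $\zeta\mapsto\eta^*(\zeta)$ are continuously differentiable on $\mathbb R$, for all $x,x'\in{\sf X}$. -/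

import Mathlib

/-!
Markov decision processes with Kullback--Leibler control cost on a finite product state space
`Xu × Xn`.  The `Xu`-component of the next state is drawn by the controller, the
`Xn`-component is drawn by nature according to the fixed kernel `Q0`.
-/

namespace KLMDP

noncomputable section

section General

variable {X : Type*} [Fintype X]

/-- A nonnegative kernel whose rows sum to one: every row is a probability mass function. -/
def IsStochastic {Y : Type*} [Fintype Y] (R : X → Y → ℝ) : Prop :=
  ∀ x, R x ∈ stdSimplex ℝ Y

/-- `P` is aperiodic: for every state `x`, the greatest common divisor of the
possible return times `{n ≥ 1 : Pⁿ(x,x) > 0}` is one. -/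
def IsAperiodic [DecidableEq X] (P : Matrix X X ℝ) : Prop :=
  ∀ x : X, ∀ d : ℕ, (∀ n : ℕ, 1 ≤ n → 0 < (P ^ n) x x → d ∣ n) → d = 1

open Classical in
/-- Relative entropy `D(μ ‖ ν) = ∑ μ log (μ / ν)` of probability mass functions on a finite set,
with `0 log 0 = 0`, and with value `+∞` when `μ` is not absolutely continuous
with respect to `ν`. -/
def relEntropy (μ ν : X → ℝ) : EReal :=
  if ∀ y, ν y = 0 → μ y = 0 then ((∑ y, μ y * Real.log (μ y / ν y) : ℝ) : EReal) else ⊤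

/-- Donsker--Varadhan rate `K(P ‖ P₀) = ∑ₓ π(x) D(P(x,·) ‖ P₀(x,·))`, where `π` is invariant for
`P` (in `EReal`, `0 * ⊤ = 0`). -/
def dvRate (P0 : Matrix X X ℝ) (π : X → ℝ) (P : Matrix X X ℝ) : EReal :=
  ∑ x, (π x : EReal) * relEntropy (P x) (P0 x)

/-- The log moment generating function
`Λ_g(x) = log ∑_{x'} P₀(x,x') exp (g(x' ∣ x))`; the value `g(x' ∣ x)` is written `g x x'`. -/
def logMGF (P0 : Matrix X X ℝ) (g : X → X → ℝ) (x : X) : ℝ :=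
  Real.log (∑ x', P0 x x' * Real.exp (g x x'))

end General

section Model

variable {Xu Xn : Type*} [Fintype Xu] [Fintype Xn]

/-- The transition probabilities out of `x` when `x_u'` is drawn from the pmf `μ` and,
independently given `x`, `x_n'` is drawn from `Q0(x,·)`. -/
def nextLaw (Q0 : Xu × Xn → Xn → ℝ) (x : Xu × Xn) (μ : Xu → ℝ) : Xu × Xn → ℝ :=
  fun x' => μ x'.1 * Q0 x x'.2

/-- The transition matrix `P(x,x') = R(x,x_u') Q₀(x,x_n')` of a randomized decision rule `R`. -/
def transMat (Q0 : Xu × Xn → Xn → ℝ) (R : Xu × Xn → Xu → ℝ) : Matrix (Xu × Xn) (Xu × Xn) ℝ :=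
  Matrix.of fun x => nextLaw Q0 x (R x)

/-- The one-step reward `ζ U(x) - D(P(x,·) ‖ P₀(x,·))` when `μ = R(x,·)` is used in state `x`;
here `P = R ⊗ Q₀` and `P₀ = R₀ ⊗ Q₀`. -/
def reward (U : Xu × Xn → ℝ) (R0 : Xu × Xn → Xu → ℝ) (Q0 : Xu × Xn → Xn → ℝ) (ζ : ℝ)
    (x : Xu × Xn) (μ : Xu → ℝ) : EReal :=
  ((ζ * U x : ℝ) : EReal) - relEntropy (nextLaw Q0 x μ) (transMat Q0 R0 x)

/-- The conditional expectation `h(x_u' ∣ x) = ∑_{x_n'} Q₀(x,x_n') h(x_u',x_n')`. -/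
def condExpQ (Q0 : Xu × Xn → Xn → ℝ) (h : Xu × Xn → ℝ) (x : Xu × Xn) (u : Xu) : ℝ :=
  ∑ n, Q0 x n * h (u, n)

/-- Admissible policies: at time `t` the pmf of the next `Xu`-component may depend on the
whole history `X(0), …, X(t)`. -/
structure Policy (Xu Xn : Type*) [Fintype Xu] where
  /-- the pmf used at time `t` after a given history -/
  rule : (t : ℕ) → (Fin (t + 1) → Xu × Xn) → Xu → ℝ
  isPmf : ∀ t s, rule t s ∈ stdSimplex ℝ Xu

/-- The stationary policy that applies the randomized decision rule `R` to the current state. -/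
def stationary (R : Xu × Xn → Xu → ℝ) (hR : IsStochastic R) : Policy Xu Xn where
  rule t s := R (s (Fin.last t))
  isPmf t s := hR (s (Fin.last t))

open Classical in
/-- The probability of the history `(X(0), …, X(t)) = s` under the policy `φ`
when `X(0) = x`. -/
def historyProb (Q0 : Xu × Xn → Xn → ℝ) (φ : Policy Xu Xn) (x : Xu × Xn) :
    (t : ℕ) → (Fin (t + 1) → Xu × Xn) → ℝ
  | 0, s => if s 0 = x then 1 else 0
  | t + 1, s =>
      let s' : Fin (t + 1) → Xu × Xn := fun i => s i.castSucc
      historyProb Q0 φ x t s' *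
        nextLaw Q0 (s' (Fin.last t)) (φ.rule t s') (s (Fin.last (t + 1)))

/-- The expected reward `E_x[w(X(t), R(t))]` at time `t`. -/
def expReward (U : Xu × Xn → ℝ) (R0 : Xu × Xn → Xu → ℝ) (Q0 : Xu × Xn → Xn → ℝ) (ζ : ℝ)
    (φ : Policy Xu Xn) (x : Xu × Xn) (t : ℕ) : EReal :=
  ∑ s : Fin (t + 1) → Xu × Xn, (historyProb Q0 φ x t s : EReal) *
    reward U R0 Q0 ζ (s (Fin.last t)) (φ.rule t s)

/-- The average reward `liminf_{T → ∞} (1/T) ∑_{t < T} E_x[w(X(t), R(t))]`. -/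
def avgReward (U : Xu × Xn → ℝ) (R0 : Xu × Xn → Xu → ℝ) (Q0 : Xu × Xn → Xn → ℝ) (ζ : ℝ)
    (φ : Policy Xu Xn) (x : Xu × Xn) : EReal :=
  Filter.liminf
    (fun T : ℕ => (∑ t ∈ Finset.range T, expReward U R0 Q0 ζ φ x t) / ((T : ℝ) : EReal))
    Filter.atTop

/-- The function maximized in the average-reward optimality equation at the state `x`:
`w(x,R) + ∑_{x'} P(x,x') h(x')` with `P = R ⊗ Q₀`. -/
def bellman (U : Xu × Xn → ℝ) (R0 : Xu × Xn → Xu → ℝ) (Q0 : Xu × Xn → Xn → ℝ) (ζ : ℝ)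
    (h : Xu × Xn → ℝ) (x : Xu × Xn) (R : Xu × Xn → Xu → ℝ) : EReal :=
  reward U R0 Q0 ζ x (R x) + ((∑ x', transMat Q0 R x x' * h x' : ℝ) : EReal)

/-- The average-reward optimality equation:
`max_R { w(x,R) + ∑_{x'} P(x,x') h(x') } = h(x) + η` for every `x`, the maximum being attained. -/
def IsAROESolution (U : Xu × Xn → ℝ) (R0 : Xu × Xn → Xu → ℝ) (Q0 : Xu × Xn → Xn → ℝ) (ζ : ℝ)
    (h : Xu × Xn → ℝ) (η : ℝ) : Prop :=
  ∀ x, IsGreatest (bellman U R0 Q0 ζ h x '' {R | IsStochastic R}) ((h x + η : ℝ) : EReal)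

/-- Pairs `(π, P)` where `P = R ⊗ Q₀` for some randomized decision rule `R` and `π` is an
invariant pmf of `P`. -/
def feasible (Q0 : Xu × Xn → Xn → ℝ) :
    Set ((Xu × Xn → ℝ) × Matrix (Xu × Xn) (Xu × Xn) ℝ) :=
  {q | q.1 ∈ stdSimplex ℝ (Xu × Xn) ∧ (∃ R, IsStochastic R ∧ q.2 = transMat Q0 R) ∧
    Matrix.vecMul q.1 q.2 = q.1}

/-- The objective `ζ π(U) - K(P ‖ P₀)` with `P₀ = R₀ ⊗ Q₀`. -/
def objective (U : Xu × Xn → ℝ) (R0 : Xu × Xn → Xu → ℝ) (Q0 : Xu × Xn → Xn → ℝ) (ζ : ℝ)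
    (q : (Xu × Xn → ℝ) × Matrix (Xu × Xn) (Xu × Xn) ℝ) : EReal :=
  ((ζ * ∑ x, q.1 x * U x : ℝ) : EReal) - dvRate (transMat Q0 R0) q.1 q.2

/-- `(π, P)` maximizes `ζ π(U) - K(P ‖ P₀)` over all feasible pairs. -/
def IsOptimizer (U : Xu × Xn → ℝ) (R0 : Xu × Xn → Xu → ℝ) (Q0 : Xu × Xn → Xn → ℝ) (ζ : ℝ)
    (π : Xu × Xn → ℝ) (P : Matrix (Xu × Xn) (Xu × Xn) ℝ) : Prop :=
  (π, P) ∈ feasible Q0 ∧ IsMaxOn (objective U R0 Q0 ζ) (feasible Q0) (π, P)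

end Model

end

end KLMDP

namespace KLMDP

/-! ### Finite Markov chains: almost subharmonic functions and Poisson's equation. -/

section Chains

variable {X : Type*}

/-! Write Λ_h for `cumulant`. By Gibbs' variational formula the maximum in the AROE at x is ζU(x) +
Λ_h(x), attained by tilting R₀ with h(x_u' | x); since x_n' is out of the controller's reach,
replacing h by h(· | x) does not change its mean under P(x,·). The AROE thus becomes ζU + Λ_h = h +
η. As Λ commutes with adding constants, v = h + η merges the two unknowns, and with h(x₀) = 0 the
equation reads F(v) = v + v(x₀) - Λ_v = ζU (`aroeMap`).

F is a diffeomorphism. Its derivative at v is g ↦ g + g(x₀) - P_v g, where the tilted kernel P_v is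
irreducible because P₀ is; Poisson's equation makes it invertible, so F is open. The bound
`exists_norm_le_aroeMap` makes F proper, hence onto, and convexity of Λ with the maximum principle
makes it injective. So v is C¹ in ζ, and with it h, η and the tilted kernel; the invariant law
follows by Cramer's formula.

Optimality is a verification argument: the Gibbs inequality bounds the one-step reward by h(x) + η -
∑ P(x,x') h(x'), with equality for the tilt. The h terms cancel under an invariant law; along a
policy they telescope and vanish after division by T. -/

theorem IsStochastic.sum_mul_le {Y : Type*} [Fintype Y] {P : X → Y → ℝ} (hP : IsStochastic P)
    {f : Y → ℝ} {c : ℝ} (hf : ∀ y, f y ≤ c) (x : X) : ∑ y, P x y * f y ≤ c :=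
  calc ∑ y, P x y * f y ≤ ∑ y, P x y * c :=
        Finset.sum_le_sum fun y _ => mul_le_mul_of_nonneg_left (hf y) ((hP x).1 y)
    _ = c := by rw [← Finset.sum_mul, (hP x).2, one_mul]

theorem IsStochastic.le_sum_mul {Y : Type*} [Fintype Y] {P : X → Y → ℝ} (hP : IsStochastic P)
    {f : Y → ℝ} {c : ℝ} (hf : ∀ y, c ≤ f y) (x : X) : c ≤ ∑ y, P x y * f y :=
  calc c = ∑ y, P x y * c := by rw [← Finset.sum_mul, (hP x).2, one_mul]
    _ ≤ ∑ y, P x y * f y :=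
        Finset.sum_le_sum fun y _ => mul_le_mul_of_nonneg_left (hf y) ((hP x).1 y)

variable [Fintype X] [DecidableEq X] {P : Matrix X X ℝ}

theorem IsStochastic.pow (hP : IsStochastic P) (n : ℕ) : IsStochastic (P ^ n) := by
  induction n with
  | zero =>
    intro x
    refine ⟨fun y => ?_, by simp [Matrix.one_apply]⟩
    rw [pow_zero, Matrix.one_apply]
    split_ifs <;> norm_num
  | succ n ih =>
    intro x
    constructor
    · intro y
      rw [pow_succ, Matrix.mul_apply]
      exact Finset.sum_nonneg fun z _ => mul_nonneg ((ih x).1 z) ((hP z).1 y)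
    · simp only [pow_succ, Matrix.mul_apply]
      rw [Finset.sum_comm]
      simp only [← Finset.mul_sum, (hP _).2, mul_one, (ih x).2]

theorem IsStochastic.sub_mul_le_pow_mulVec (hP : IsStochastic P) {f : X → ℝ} {c : ℝ}
    (hf : ∀ x, f x - c ≤ (P.mulVec f) x) (n : ℕ) (x : X) :
    f x - n * c ≤ ((P ^ n).mulVec f) x := by
  induction n generalizing x with
  | zero => simp
  | succ n ih =>
    have h1 : ((P ^ (n + 1)).mulVec f) x = ∑ y, P x y * ((P ^ n).mulVec f) y := by
      rw [pow_succ', ← Matrix.mulVec_mulVec]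
      rfl
    have h2 : ∑ y, P x y * (f y - n * c) ≤ ∑ y, P x y * ((P ^ n).mulVec f) y :=
      Finset.sum_le_sum fun y _ => mul_le_mul_of_nonneg_left (ih y) ((hP x).1 y)
    have h3 : ∑ y, P x y * (f y - n * c) = (P.mulVec f) x - n * c := by
      simp only [mul_sub, Finset.sum_sub_distrib, ← Finset.sum_mul, (hP x).2, one_mul]
      rfl
    have := hf x
    push_cast
    linarith

/-- For an irreducible chain, the oscillation of an almost subharmonic function is controlled
by its defect. -/
theorem IsStochastic.exists_oscillation_bound [Nonempty X] (hP : IsStochastic P)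
    (hirr : ∀ x y, ∃ n : ℕ, 0 < (P ^ n) x y) :
    ∃ K : ℝ, 0 ≤ K ∧ ∀ (f : X → ℝ) (c : ℝ), 0 ≤ c → (∀ x, f x - c ≤ (P.mulVec f) x) →
      ∀ x y, f x - f y ≤ K * c := by
  choose n hn using hirr
  -- Each pair costs n / Pⁿ(z,y); the sum over all pairs dominates every single cost, independently
  -- of f.
  refine ⟨∑ z, ∑ y, (n z y : ℝ) / (P ^ n z y) z y,
    Finset.sum_nonneg fun z _ => Finset.sum_nonneg fun y _ => by have := hn z y; positivity, ?_⟩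
  intro f c hc hf x y
  obtain ⟨z, hz⟩ := Finite.exists_max f
  have hpos := hn z y
  have h1 := hP.sub_mul_le_pow_mulVec hf (n z y) z
  have hQ := hP.pow (n z y)
  have h2 : ∑ w, (P ^ n z y) z w * (f z - f w) = f z - ((P ^ n z y).mulVec f) z := by
    simp only [mul_sub, Finset.sum_sub_distrib, ← Finset.sum_mul, (hQ z).2, one_mul]
    rfl
  -- At a maximizer z all summands are nonnegative, so the y-term alone is at most f z - Pⁿf(z) ≤ n
  -- c.
  have h3 : (P ^ n z y) z y * (f z - f y) ≤ ∑ w, (P ^ n z y) z w * (f z - f w) :=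
    Finset.single_le_sum (f := fun w => (P ^ n z y) z w * (f z - f w))
      (fun w _ => mul_nonneg ((hQ z).1 w) (sub_nonneg.2 (hz w))) (Finset.mem_univ y)
  have h4 : f z - f y ≤ (n z y : ℝ) / (P ^ n z y) z y * c := by
    rw [div_mul_eq_mul_div, le_div_iff₀ hpos]
    linarith
  have h5 : (n z y : ℝ) / (P ^ n z y) z y ≤ ∑ z, ∑ y, (n z y : ℝ) / (P ^ n z y) z y := by
    have h6 : ∀ z y, 0 ≤ (n z y : ℝ) / (P ^ n z y) z y := fun z y => by
      have := hn z y
      positivity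
    exact (Finset.single_le_sum (f := fun y => (n z y : ℝ) / (P ^ n z y) z y)
      (fun y _ => h6 z y) (Finset.mem_univ y)).trans
      (Finset.single_le_sum (f := fun z => ∑ y, (n z y : ℝ) / (P ^ n z y) z y)
        (fun z _ => Finset.sum_nonneg fun y _ => h6 z y) (Finset.mem_univ z))
  have := hz x
  have := mul_le_mul_of_nonneg_right h5 hc
  linarith

theorem IsStochastic.eq_of_subharmonic [Nonempty X] (hP : IsStochastic P)
    (hirr : ∀ x y, ∃ n : ℕ, 0 < (P ^ n) x y) {f : X → ℝ} (hf : ∀ x, f x ≤ (P.mulVec f) x)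
    (x y : X) : f x = f y := by
  obtain ⟨K, -, hK⟩ := hP.exists_oscillation_bound hirr
  have h := hK f 0 le_rfl (by simpa using hf)
  have h1 := h x y
  have h2 := h y x
  linarith

/-- A solution `g` of Poisson's equation `P g - g = c` with constant forcing is constant,
and `c = 0`. -/
theorem IsStochastic.poisson_const [Nonempty X] (hP : IsStochastic P)
    (hirr : ∀ x y, ∃ n : ℕ, 0 < (P ^ n) x y) {g : X → ℝ} {c : ℝ}
    (hg : ∀ x, (P.mulVec g) x - g x = c) : c = 0 ∧ ∀ x y, g x = g y := by
  obtain ⟨a, ha⟩ := Finite.exists_max g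
  obtain ⟨b, hb⟩ := Finite.exists_min g
  have h1 : (P.mulVec g) a ≤ g a := hP.sum_mul_le ha a
  have h2 : g b ≤ (P.mulVec g) b := hP.le_sum_mul hb b
  have hc : c = 0 := by
    have := hg a
    have := hg b
    linarith
  exact ⟨hc, hP.eq_of_subharmonic hirr fun x => by linarith [hg x]⟩

/-- An entry of a power is positive exactly when a path of positive entries realizes it, so only the
support matters. This transfers irreducibility to tilted kernels. -/
theorem pow_apply_pos_of_pos {A B : Matrix X X ℝ} (hA : ∀ x y, 0 ≤ A x y)
    (hB : ∀ x y, 0 ≤ B x y) (h : ∀ x y, 0 < A x y → 0 < B x y) (n : ℕ) (x y : X)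
    (hn : 0 < (A ^ n) x y) : 0 < (B ^ n) x y := by
  have hnn : ∀ (C : Matrix X X ℝ), (∀ x y, 0 ≤ C x y) → ∀ (n : ℕ) x y, 0 ≤ (C ^ n) x y := by
    intro C hC n
    induction n with
    | zero =>
      intro x y
      rw [pow_zero, Matrix.one_apply]
      split_ifs <;> norm_num
    | succ n ih =>
      intro x y
      rw [pow_succ, Matrix.mul_apply]
      exact Finset.sum_nonneg fun z _ => mul_nonneg (ih x z) (hC z y)
  induction n generalizing x y with
  | zero => simpa using hn
  | succ n ih =>
    rw [pow_succ, Matrix.mul_apply] at hn ⊢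
    obtain ⟨z, -, hz⟩ := Finset.exists_lt_of_sum_lt (s := Finset.univ)
      (f := fun _ : X => (0 : ℝ)) (g := fun z => (A ^ n) x z * A z y) (by simpa using hn)
    have hz1 : 0 < (A ^ n) x z := (hnn A hA n x z).lt_of_ne fun h0 => by simp [← h0] at hz
    have hz2 : 0 < A z y := (hA z y).lt_of_ne fun h0 => by simp [← h0] at hz
    exact Finset.sum_pos' (fun w _ => mul_nonneg (hnn B hB n x w) (hB w y))
      ⟨z, Finset.mem_univ z, mul_pos (ih x z hz1) (h z y hz2)⟩

end Chains

/-! ### Gibbs' variational principle and convexity of the log moment generating function. -/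

section Gibbs

variable {Y : Type*} [Fintype Y] {p q : Y → ℝ}

theorem sum_mul_exp_pos (hq : q ∈ stdSimplex ℝ Y) (g : Y → ℝ) :
    0 < ∑ y, q y * Real.exp (g y) := by
  obtain ⟨y, -, hy⟩ := Finset.exists_lt_of_sum_lt (s := Finset.univ)
    (f := fun _ : Y => (0 : ℝ)) (g := q) (by simp [hq.2])
  exact Finset.sum_pos' (fun w _ => mul_nonneg (hq.1 w) (Real.exp_pos _).le)
    ⟨y, Finset.mem_univ y, mul_pos hy (Real.exp_pos _)⟩

theorem sum_mul_exp_sub_log (hq : q ∈ stdSimplex ℝ Y) (g : Y → ℝ) :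
    ∑ y, q y * Real.exp (g y - Real.log (∑ y, q y * Real.exp (g y))) = 1 := by
  have hZ := sum_mul_exp_pos hq g
  simp only [Real.exp_sub, Real.exp_log hZ, mul_div_assoc', ← Finset.sum_div]
  exact div_self hZ.ne'

/-- Gibbs' variational inequality. -/
theorem sum_mul_sub_log_le_relEntropy (hp : p ∈ stdSimplex ℝ Y) (hq : q ∈ stdSimplex ℝ Y)
    (g : Y → ℝ) :
    ((∑ y, p y * g y - Real.log (∑ y, q y * Real.exp (g y)) : ℝ) : EReal) ≤ relEntropy p q := by
  unfold relEntropy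
  split_ifs with hac
  · rw [EReal.coe_le_coe_iff]
    set Λ := Real.log (∑ y, q y * Real.exp (g y)) with hΛ
    -- This is log t ≤ t - 1 at t = q e^(g-Λ) / p, multiplied by p. The right-hand sides sum to 1 -
    -- 1 = 0.
    have key : ∀ y, p y * (g y - Λ) - p y * Real.log (p y / q y) ≤
        q y * Real.exp (g y - Λ) - p y := by
      intro y
      rcases (hp.1 y).eq_or_lt with h0 | hpos
      · rw [← h0]
        have := mul_nonneg (hq.1 y) (Real.exp_pos (g y - Λ)).le
        simpa using this
      · have hqpos : 0 < q y := (hq.1 y).lt_of_ne fun h => hpos.ne' (hac y h.symm)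
        have h1 := Real.log_le_sub_one_of_pos
          (show 0 < q y * Real.exp (g y - Λ) / p y by positivity)
        rw [Real.log_div (by positivity) hpos.ne', Real.log_mul hqpos.ne' (Real.exp_pos _).ne',
          Real.log_exp] at h1
        rw [Real.log_div hpos.ne' hqpos.ne']
        have h2 := mul_le_mul_of_nonneg_left h1 hpos.le
        have h3 : p y * (q y * Real.exp (g y - Λ) / p y) = q y * Real.exp (g y - Λ) := by
          field_simp
        linarith
    have hs := Finset.sum_le_sum fun y (_ : y ∈ Finset.univ) => key y
    simp only [Finset.sum_sub_distrib, mul_sub, ← Finset.sum_mul, hp.2, one_mul,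
      hΛ, sum_mul_exp_sub_log hq g] at hs
    rw [← hΛ] at hs
    linarith
  · exact le_top

theorem relEntropy_tilt (hq : q ∈ stdSimplex ℝ Y) (g : Y → ℝ)
    (hpq : ∀ y, p y = q y * Real.exp (g y - Real.log (∑ y, q y * Real.exp (g y)))) :
    relEntropy p q =
      ((∑ y, p y * g y - Real.log (∑ y, q y * Real.exp (g y)) : ℝ) : EReal) := by
  unfold relEntropy
  rw [if_pos fun y hy => by rw [hpq, hy, zero_mul]]
  congr 1
  have hsum : ∑ y, p y = 1 := by
    simp only [hpq]
    exact sum_mul_exp_sub_log hq g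
  have h : ∀ y, p y * Real.log (p y / q y) =
      p y * (g y - Real.log (∑ y, q y * Real.exp (g y))) := by
    intro y
    by_cases h0 : q y = 0
    · simp [hpq y, h0]
    · nth_rewrite 2 [hpq y]
      rw [mul_div_cancel_left₀ _ h0, Real.log_exp]
  simp only [h, mul_sub, Finset.sum_sub_distrib, ← Finset.sum_mul, hsum, one_mul]

/-- The subgradient inequality for the log moment generating function. -/
theorem log_sum_mul_exp_add_le (hq : q ∈ stdSimplex ℝ Y) (f g : Y → ℝ)
    (hpq : ∀ y, p y = q y * Real.exp (g y - Real.log (∑ y, q y * Real.exp (g y)))) :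
    Real.log (∑ y, q y * Real.exp (g y)) + ∑ y, p y * (f y - g y) ≤
      Real.log (∑ y, q y * Real.exp (f y)) := by
  have hp : p ∈ stdSimplex ℝ Y := by
    refine ⟨fun y => ?_, ?_⟩
    · rw [hpq]
      exact mul_nonneg (hq.1 y) (Real.exp_pos _).le
    · simp only [hpq]
      exact sum_mul_exp_sub_log hq g
  have h := sum_mul_sub_log_le_relEntropy hp hq f
  rw [relEntropy_tilt hq g hpq, EReal.coe_le_coe_iff] at h
  simp only [mul_sub, Finset.sum_sub_distrib]
  linarith

/-- Jensen's inequality, as the subgradient inequality at the zero function, where the tilt is q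
itself. -/
theorem sum_mul_le_log_sum_mul_exp (hq : q ∈ stdSimplex ℝ Y) (g : Y → ℝ) :
    ∑ y, q y * g y ≤ Real.log (∑ y, q y * Real.exp (g y)) := by
  simpa [hq.2] using log_sum_mul_exp_add_le (p := q) hq g 0 (by simp [hq.2])

theorem log_sum_mul_exp_le (hq : q ∈ stdSimplex ℝ Y) {g : Y → ℝ} {c : ℝ} (hg : ∀ y, g y ≤ c) :
    Real.log (∑ y, q y * Real.exp (g y)) ≤ c := by
  rw [Real.log_le_iff_le_exp (sum_mul_exp_pos hq g)]
  calc ∑ y, q y * Real.exp (g y) ≤ ∑ y, q y * Real.exp c := Finset.sum_le_sum fun y _ =>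
        mul_le_mul_of_nonneg_left (Real.exp_le_exp.2 (hg y)) (hq.1 y)
    _ = Real.exp c := by rw [← Finset.sum_mul, hq.2, one_mul]

end Gibbs

end KLMDP

namespace KLMDP

/-! ### The kernel tilted by h(x_u' | x), and its cumulant. -/

section TiltedKernel

theorem condExpQ_add_const {Xu Xn : Type*} [Fintype Xn] {Q0 : Xu × Xn → Xn → ℝ}
    (hQ0 : IsStochastic Q0) (h : Xu × Xn → ℝ) (c : ℝ) (x : Xu × Xn)
    (u : Xu) : condExpQ Q0 (fun y => h y + c) x u = condExpQ Q0 h x u + c := by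
  simp only [condExpQ, mul_add, Finset.sum_add_distrib, ← Finset.sum_mul, (hQ0 x).2, one_mul]

variable {Xu Xn : Type*} [Fintype Xu] [Fintype Xn]
  {R0 R : Xu × Xn → Xu → ℝ} {Q0 : Xu × Xn → Xn → ℝ}

theorem nextLaw_mem_stdSimplex (hQ0 : IsStochastic Q0) (x : Xu × Xn) {μ : Xu → ℝ}
    (hμ : μ ∈ stdSimplex ℝ Xu) : nextLaw Q0 x μ ∈ stdSimplex ℝ (Xu × Xn) := by
  refine ⟨fun y => mul_nonneg (hμ.1 _) ((hQ0 x).1 _), ?_⟩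
  simp only [nextLaw, Fintype.sum_prod_type, ← Finset.mul_sum, (hQ0 x).2, mul_one, hμ.2]

theorem IsStochastic.transMat (hQ0 : IsStochastic Q0) (hR : IsStochastic R) :
    IsStochastic (transMat Q0 R) :=
  fun x => nextLaw_mem_stdSimplex hQ0 x (hR x)

theorem sum_nextLaw_mul_fst (hQ0 : IsStochastic Q0) (x : Xu × Xn) (μ f : Xu → ℝ) :
    ∑ x', nextLaw Q0 x μ x' * f x'.1 = ∑ u, μ u * f u := by
  simp only [nextLaw, Fintype.sum_prod_type, mul_right_comm (μ _) (Q0 x _)]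
  simp only [← Finset.mul_sum, (hQ0 x).2, mul_one]

/-- Tower property: given x, the components x_u' and x_n' are independent. It lets a tilt by a
function of x_u' alone handle the expectation of h. -/
theorem sum_nextLaw_mul_condExpQ (hQ0 : IsStochastic Q0) (x : Xu × Xn) (μ : Xu → ℝ)
    (h : Xu × Xn → ℝ) :
    ∑ x', nextLaw Q0 x μ x' * condExpQ Q0 h x x'.1 = ∑ x', nextLaw Q0 x μ x' * h x' := by
  rw [sum_nextLaw_mul_fst hQ0]
  simp only [nextLaw, condExpQ, Fintype.sum_prod_type, Finset.mul_sum, mul_assoc]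

variable (R0 Q0) in
/-- The log moment generating function of `x' ↦ h(x_u' ∣ x)` under the nominal kernel. -/
noncomputable def cumulant (h : Xu × Xn → ℝ) (x : Xu × Xn) : ℝ :=
  logMGF (transMat Q0 R0) (fun y y' => condExpQ Q0 h y y'.1) x

variable (R0 Q0) in
/-- The decision rule obtained by tilting the nominal one with `h(x_u' ∣ x)`. -/
noncomputable def tiltedRule (h : Xu × Xn → ℝ) (x : Xu × Xn) (u : Xu) : ℝ :=
  R0 x u * Real.exp (condExpQ Q0 h x u - cumulant R0 Q0 h x)

theorem cumulant_eq (h : Xu × Xn → ℝ) (x : Xu × Xn) : cumulant R0 Q0 h x =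
    Real.log (∑ x', nextLaw Q0 x (R0 x) x' * Real.exp (condExpQ Q0 h x x'.1)) := rfl

theorem nextLaw_tiltedRule (h : Xu × Xn → ℝ) (x x' : Xu × Xn) :
    nextLaw Q0 x (tiltedRule R0 Q0 h x) x' = nextLaw Q0 x (R0 x) x' *
      Real.exp (condExpQ Q0 h x x'.1 - cumulant R0 Q0 h x) := by
  simp only [nextLaw, tiltedRule]
  ring

theorem isStochastic_tiltedRule (hR0 : IsStochastic R0) (hQ0 : IsStochastic Q0)
    (h : Xu × Xn → ℝ) : IsStochastic (tiltedRule R0 Q0 h) := by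
  refine fun x => ⟨fun u => mul_nonneg ((hR0 x).1 u) (Real.exp_pos _).le, ?_⟩
  rw [← sum_mul_exp_sub_log (nextLaw_mem_stdSimplex hQ0 x (hR0 x)) fun x' => condExpQ Q0 h x x'.1]
  exact (sum_nextLaw_mul_fst hQ0 x (R0 x) fun u => Real.exp (condExpQ Q0 h x u -
    cumulant R0 Q0 h x)).symm

theorem cumulant_add_const (hR0 : IsStochastic R0) (hQ0 : IsStochastic Q0)
    (h : Xu × Xn → ℝ) (c : ℝ) (x : Xu × Xn) :
    cumulant R0 Q0 (fun y => h y + c) x = cumulant R0 Q0 h x + c := by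
  simp only [cumulant_eq, condExpQ_add_const hQ0, Real.exp_add, ← mul_assoc, ← Finset.sum_mul]
  rw [Real.log_mul (sum_mul_exp_pos (nextLaw_mem_stdSimplex hQ0 x (hR0 x)) _).ne'
    (Real.exp_pos _).ne', Real.log_exp]

theorem transMat_mulVec_le_cumulant (hR0 : IsStochastic R0) (hQ0 : IsStochastic Q0)
    (h : Xu × Xn → ℝ) (x : Xu × Xn) :
    ((transMat Q0 R0).mulVec h) x ≤ cumulant R0 Q0 h x := by
  have := sum_mul_le_log_sum_mul_exp (nextLaw_mem_stdSimplex hQ0 x (hR0 x))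
    fun x' => condExpQ Q0 h x x'.1
  rw [sum_nextLaw_mul_condExpQ hQ0] at this
  exact this

theorem cumulant_le (hR0 : IsStochastic R0) (hQ0 : IsStochastic Q0)
    {h : Xu × Xn → ℝ} {c : ℝ} (hc : ∀ x, h x ≤ c) (x : Xu × Xn) : cumulant R0 Q0 h x ≤ c :=
  log_sum_mul_exp_le (nextLaw_mem_stdSimplex hQ0 x (hR0 x))
    fun x' => hQ0.sum_mul_le (fun n => hc (x'.1, n)) x

/-- Convexity of the cumulant: the tilted kernel at h is its gradient there, by
`hasFDerivAt_cumulant`. -/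
theorem cumulant_add_tilted_le (hR0 : IsStochastic R0) (hQ0 : IsStochastic Q0)
    (f h : Xu × Xn → ℝ) (x : Xu × Xn) :
    cumulant R0 Q0 h x + ((transMat Q0 (tiltedRule R0 Q0 h)).mulVec (f - h)) x ≤
      cumulant R0 Q0 f x := by
  have := log_sum_mul_exp_add_le (nextLaw_mem_stdSimplex hQ0 x (hR0 x))
    (fun x' => condExpQ Q0 f x x'.1) (fun x' => condExpQ Q0 h x x'.1) (nextLaw_tiltedRule h x)
  simp only [mul_sub, Finset.sum_sub_distrib, sum_nextLaw_mul_condExpQ hQ0] at this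
  rw [Matrix.mulVec_sub]
  exact this

variable [DecidableEq Xu] [DecidableEq Xn]

theorem exists_pow_transMat_tiltedRule_pos (hR0 : IsStochastic R0) (hQ0 : IsStochastic Q0)
    (hirr : ∀ x y, ∃ n : ℕ, 0 < (transMat Q0 R0 ^ n) x y) (h : Xu × Xn → ℝ) (x y : Xu × Xn) :
    ∃ n : ℕ, 0 < (transMat Q0 (tiltedRule R0 Q0 h) ^ n) x y := by
  obtain ⟨n, hn⟩ := hirr x y
  refine ⟨n, pow_apply_pos_of_pos (fun x y => (hQ0.transMat hR0 x).1 y)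
    (fun x y => (hQ0.transMat (isStochastic_tiltedRule hR0 hQ0 h) x).1 y) ?_ n x y hn⟩
  intro x y hxy
  change 0 < nextLaw Q0 x (tiltedRule R0 Q0 h x) y
  rw [nextLaw_tiltedRule]
  exact mul_pos hxy (Real.exp_pos _)

end TiltedKernel

/-! ### Global inversion of the optimality equation. -/

section OptimalityEquation

variable {Xu Xn : Type*} [Fintype Xu] [Fintype Xn] {R0 : Xu × Xn → Xu → ℝ} {Q0 : Xu × Xn → Xn → ℝ}

variable (R0 Q0) in
/-- The map whose value at `v = h + η`, with `h x₀ = 0`, is the one-step reward function for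
which `(h, η)` solves the average-reward optimality equation. -/
noncomputable def aroeMap (x₀ : Xu × Xn) (v : Xu × Xn → ℝ) (x : Xu × Xn) : ℝ :=
  v x + v x₀ - cumulant R0 Q0 v x

theorem contDiff_cumulant (hR0 : IsStochastic R0) (hQ0 : IsStochastic Q0) {n : ℕ∞}
    (x : Xu × Xn) : ContDiff ℝ n fun v => cumulant R0 Q0 v x := by
  simp only [cumulant_eq]
  refine ContDiff.log ?_ fun v =>
    (sum_mul_exp_pos (nextLaw_mem_stdSimplex hQ0 x (hR0 x)) _).ne'
  unfold condExpQ
  fun_prop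

theorem contDiff_condExpQ {n : ℕ∞} (x : Xu × Xn) (u : Xu) :
    ContDiff ℝ n fun v => condExpQ Q0 v x u := by
  unfold condExpQ
  fun_prop

theorem contDiff_aroeMap (hR0 : IsStochastic R0) (hQ0 : IsStochastic Q0) {n : ℕ∞}
    (x₀ : Xu × Xn) : ContDiff ℝ n (aroeMap R0 Q0 x₀) := by
  refine contDiff_pi.2 fun x => ?_
  unfold aroeMap
  have := contDiff_cumulant hR0 hQ0 (n := n) x
  fun_prop

theorem contDiff_transMat_tiltedRule (hR0 : IsStochastic R0) (hQ0 : IsStochastic Q0) {n : ℕ∞}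
    (x x' : Xu × Xn) : ContDiff ℝ n fun v => transMat Q0 (tiltedRule R0 Q0 v) x x' := by
  have h : ∀ v, transMat Q0 (tiltedRule R0 Q0 v) x x' = _ := fun v => nextLaw_tiltedRule v x x'
  simp only [h]
  have := contDiff_cumulant hR0 hQ0 (n := n) x
  have := contDiff_condExpQ (Q0 := Q0) (n := n) x x'.1
  fun_prop

theorem hasFDerivAt_cumulant (hR0 : IsStochastic R0) (hQ0 : IsStochastic Q0)
    (v : Xu × Xn → ℝ) (x : Xu × Xn) :
    HasFDerivAt (fun v => cumulant R0 Q0 v x)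
      (∑ x', transMat Q0 (tiltedRule R0 Q0 v) x x' • ContinuousLinearMap.proj (R := ℝ)
        (φ := fun _ : Xu × Xn => ℝ) x') v := by
  set L : Xu → (Xu × Xn → ℝ) →L[ℝ] ℝ := fun u =>
    ∑ n, Q0 x n • ContinuousLinearMap.proj (R := ℝ) (φ := fun _ : Xu × Xn => ℝ) (u, n) with hL
  have hLe : ∀ u w, L u w = condExpQ Q0 w x u := fun u w => by
    simp [hL, condExpQ]
  have hZ := sum_mul_exp_pos (nextLaw_mem_stdSimplex hQ0 x (hR0 x))
    fun x' => condExpQ Q0 v x x'.1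
  have h1 : HasFDerivAt (fun w => ∑ x', nextLaw Q0 x (R0 x) x' * Real.exp (L x'.1 w))
      (∑ x', nextLaw Q0 x (R0 x) x' • (Real.exp (L x'.1 v) • L x'.1)) v :=
    HasFDerivAt.fun_sum fun x' _ => ((L x'.1).hasFDerivAt.exp).const_mul _
  have h2 := h1.log (by simpa only [hLe] using hZ.ne')
  simp only [hLe] at h2
  refine h2.congr_fderiv ?_
  ext w
  -- Differentiating the logarithm gives the tilted mean of h(x_u' | x); the tower property turns it
  -- into the tilted mean of h.
  have h3 := sum_nextLaw_mul_condExpQ hQ0 x (tiltedRule R0 Q0 v x) w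
  simp only [nextLaw_tiltedRule, Real.exp_sub, cumulant_eq, Real.exp_log hZ] at h3
  simp only [_root_.smul_apply, _root_.sum_apply, smul_eq_mul, hLe,
    ContinuousLinearMap.proj_apply, transMat, Matrix.of_apply, nextLaw_tiltedRule, Real.exp_sub,
    cumulant_eq, Real.exp_log hZ]
  rw [← h3, Finset.mul_sum]
  refine Finset.sum_congr rfl fun x' _ => ?_
  ring

variable [DecidableEq Xu] [DecidableEq Xn]

theorem exists_hasFDerivAt_aroeMap (hR0 : IsStochastic R0) (hQ0 : IsStochastic Q0)
    (hirr : ∀ x y, ∃ n : ℕ, 0 < (transMat Q0 R0 ^ n) x y) (x₀ : Xu × Xn) (v : Xu × Xn → ℝ) :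
    ∃ D : (Xu × Xn → ℝ) ≃L[ℝ] (Xu × Xn → ℝ),
      HasFDerivAt (aroeMap R0 Q0 x₀) (D : (Xu × Xn → ℝ) →L[ℝ] (Xu × Xn → ℝ)) v := by
  have : Nonempty (Xu × Xn) := ⟨x₀⟩
  set P := transMat Q0 (tiltedRule R0 Q0 v) with hP
  set A : (Xu × Xn → ℝ) →L[ℝ] (Xu × Xn → ℝ) := ContinuousLinearMap.pi fun x =>
    ContinuousLinearMap.proj (R := ℝ) (φ := fun _ : Xu × Xn => ℝ) x +
    ContinuousLinearMap.proj (R := ℝ) (φ := fun _ : Xu × Xn => ℝ) x₀ -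
    ∑ x', P x x' • ContinuousLinearMap.proj (R := ℝ) (φ := fun _ : Xu × Xn => ℝ) x' with hA
  have hAd : HasFDerivAt (aroeMap R0 Q0 x₀) A v :=
    hasFDerivAt_pi.2 fun x => (((ContinuousLinearMap.proj (R := ℝ)
      (φ := fun _ : Xu × Xn => ℝ) x).hasFDerivAt.add (ContinuousLinearMap.proj (R := ℝ)
      (φ := fun _ : Xu × Xn => ℝ) x₀).hasFDerivAt).sub (hasFDerivAt_cumulant hR0 hQ0 v x))
  have hinj : Function.Injective (A : (Xu × Xn → ℝ) →ₗ[ℝ] (Xu × Xn → ℝ)) := by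
    rw [← LinearMap.ker_eq_bot, LinearMap.ker_eq_bot']
    intro g hg
    -- A kernel vector solves Poisson's equation with forcing g(x₀); hence g(x₀) = 0, g is constant,
    -- and so g = 0.
    have hg' : ∀ x, (P.mulVec g) x - g x = g x₀ := fun x => by
      have := congrFun hg x
      simp only [hA, ContinuousLinearMap.coe_coe, ContinuousLinearMap.coe_pi',
        _root_.sub_apply, _root_.add_apply,
        ContinuousLinearMap.proj_apply, _root_.sum_apply,
        _root_.smul_apply, smul_eq_mul, Pi.zero_apply] at this
      simp only [Matrix.mulVec, dotProduct]
      linarith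
    obtain ⟨h0, hc⟩ := (hQ0.transMat (isStochastic_tiltedRule hR0 hQ0 v)).poisson_const
      (exists_pow_transMat_tiltedRule_pos hR0 hQ0 hirr v) hg'
    funext x
    rw [hc x x₀, h0, Pi.zero_apply]
  refine ⟨(LinearEquiv.ofInjectiveEndo _ hinj).toContinuousLinearEquiv, ?_⟩
  refine hAd.congr_fderiv ?_
  ext
  rfl

theorem aroeMap_injective (hR0 : IsStochastic R0) (hQ0 : IsStochastic Q0)
    (hirr : ∀ x y, ∃ n : ℕ, 0 < (transMat Q0 R0 ^ n) x y) (x₀ : Xu × Xn) :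
    Function.Injective (aroeMap R0 Q0 x₀) := by
  have : Nonempty (Xu × Xn) := ⟨x₀⟩
  -- The equality of the images is inserted in the subgradient inequality at g.
  have le : ∀ f g : Xu × Xn → ℝ, aroeMap R0 Q0 x₀ f = aroeMap R0 Q0 x₀ g → ∀ x,
      ((transMat Q0 (tiltedRule R0 Q0 g)).mulVec (f - g)) x ≤ (f - g) x + (f - g) x₀ := by
    intro f g hfg x
    have h1 := congrFun hfg x
    have h2 := cumulant_add_tilted_le hR0 hQ0 f g x
    simp only [aroeMap, Pi.sub_apply] at h1 ⊢
    linarith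
  have base : ∀ f g : Xu × Xn → ℝ, aroeMap R0 Q0 x₀ f = aroeMap R0 Q0 x₀ g →
      0 ≤ (f - g) x₀ := by
    intro f g hfg
    -- At a minimum of f - g averaging cannot decrease the value, so `le` forces (f - g)(x₀) ≥ 0;
    -- exchanging f and g gives equality to zero.
    obtain ⟨b, hb⟩ := Finite.exists_min (f - g)
    have h1 := le f g hfg b
    have h2 : (f - g) b ≤ ((transMat Q0 (tiltedRule R0 Q0 g)).mulVec (f - g)) b :=
      (hQ0.transMat (isStochastic_tiltedRule hR0 hQ0 g)).le_sum_mul hb b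
    linarith
  intro f g hfg
  have h0 : (f - g) x₀ = 0 := by
    have h1 := base f g hfg
    have h2 := base g f hfg.symm
    simp only [Pi.sub_apply] at h1 h2 ⊢
    linarith
  have hsub : ∀ x, (g - f) x ≤ ((transMat Q0 (tiltedRule R0 Q0 g)).mulVec (g - f)) x := by
    intro x
    have := le f g hfg x
    rw [← neg_sub f g, Matrix.mulVec_neg, Pi.neg_apply, Pi.neg_apply]
    linarith
  funext x
  have := (hQ0.transMat (isStochastic_tiltedRule hR0 hQ0 g)).eq_of_subharmonic
    (exists_pow_transMat_tiltedRule_pos hR0 hQ0 hirr g) hsub x x₀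
  simp only [Pi.sub_apply] at this h0
  linarith

/-- A priori bound. Comparing Λ_v with v at the extrema of v controls v(x₀); then -v is almost
subharmonic for P₀, which controls its oscillation. -/
theorem exists_norm_le_aroeMap (hR0 : IsStochastic R0) (hQ0 : IsStochastic Q0)
    (hirr : ∀ x y, ∃ n : ℕ, 0 < (transMat Q0 R0 ^ n) x y) (x₀ : Xu × Xn) :
    ∃ K : ℝ, 0 ≤ K ∧ ∀ v, ‖v‖ ≤ K * ‖aroeMap R0 Q0 x₀ v‖ := by
  have : Nonempty (Xu × Xn) := ⟨x₀⟩
  obtain ⟨K, hK0, hK⟩ := (hQ0.transMat hR0).exists_oscillation_bound hirr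
  refine ⟨2 * K + 1, by positivity, fun v => ?_⟩
  set M := ‖aroeMap R0 Q0 x₀ v‖ with hM
  have hM0 : 0 ≤ M := norm_nonneg _
  have hw : ∀ x, |aroeMap R0 Q0 x₀ v x| ≤ M := fun x => norm_le_pi_norm (aroeMap R0 Q0 x₀ v) x
  have h0 : |v x₀| ≤ M := by
    obtain ⟨a, ha⟩ := Finite.exists_max v
    obtain ⟨b, hb⟩ := Finite.exists_min v
    have h1 := cumulant_le hR0 hQ0 ha a
    have h2 : v b ≤ ((transMat Q0 R0).mulVec v) b := (hQ0.transMat hR0).le_sum_mul hb b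
    have h3 := transMat_mulVec_le_cumulant hR0 hQ0 v b
    have h4 := abs_le.1 (hw a)
    have h5 := abs_le.1 (hw b)
    simp only [aroeMap] at h4 h5
    exact abs_le.2 ⟨by linarith, by linarith⟩
  -- P₀v ≤ Λ_v = v + v(x₀) - F(v) ≤ v + 2M, one M for each of the last two terms. Adding |v(x₀)| ≤ M
  -- yields the constant 2K + 1.
  have hosc := hK (-v) (2 * M) (by positivity) fun x => by
    have h1 := transMat_mulVec_le_cumulant hR0 hQ0 v x
    have h2 := abs_le.1 (hw x)
    have h3 := abs_le.1 h0
    simp only [aroeMap] at h2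
    rw [Matrix.mulVec_neg, Pi.neg_apply, Pi.neg_apply]
    linarith
  refine (pi_norm_le_iff_of_nonneg (by positivity)).2 fun x => ?_
  have h1 := hosc x x₀
  have h2 := hosc x₀ x
  have h3 := abs_le.1 h0
  simp only [Pi.neg_apply] at h1 h2
  exact abs_le.2 ⟨by linarith, by linarith⟩

/-- `aroeMap` is a diffeomorphism of the space of functions: the optimality equation is uniquely
solvable for every reward function, and the solution depends smoothly on the reward. -/
theorem exists_contDiff_rightInverse_aroeMap (hR0 : IsStochastic R0) (hQ0 : IsStochastic Q0)
    (hirr : ∀ x y, ∃ n : ℕ, 0 < (transMat Q0 R0 ^ n) x y) (x₀ : Xu × Xn) {n : ℕ∞} :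
    ∃ V : (Xu × Xn → ℝ) → (Xu × Xn → ℝ), ContDiff ℝ n V ∧ ∀ w, aroeMap R0 Q0 x₀ (V w) = w := by
  have hsm : ContDiff ℝ 1 (aroeMap R0 Q0 x₀) := contDiff_aroeMap hR0 hQ0 (n := 1) x₀
  choose D hD using exists_hasFDerivAt_aroeMap hR0 hQ0 hirr x₀
  have hopen : IsOpenMap (aroeMap R0 Q0 x₀) :=
    isOpenMap_of_hasStrictFDerivAt_equiv (f' := D) fun v =>
      hsm.contDiffAt.hasStrictFDerivAt' (hD v) one_ne_zero
  obtain ⟨K, hK0, hK⟩ := exists_norm_le_aroeMap hR0 hQ0 hirr x₀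
  have hproper : IsProperMap (aroeMap R0 Q0 x₀) := by
    rw [isProperMap_iff_tendsto_cocompact]
    refine ⟨hsm.continuous, ?_⟩
    rw [← Metric.cobounded_eq_cocompact, ← tendsto_norm_atTop_iff_cobounded]
    -- Dividing by K + 1 rather than K covers the case K = 0.
    have h1 : Filter.Tendsto (fun v : Xu × Xn → ℝ => ‖v‖ / (K + 1))
        (Bornology.cobounded _) Filter.atTop :=
      tendsto_norm_cobounded_atTop.atTop_div_const (by positivity)
    refine Filter.tendsto_atTop_mono (fun v => ?_) h1
    rw [div_le_iff₀ (by positivity)]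
    have := hK v
    have := norm_nonneg (aroeMap R0 Q0 x₀ v)
    linarith
  have hsurj : Function.Surjective (aroeMap R0 Q0 x₀) := by
    -- The range is open, closed and nonempty in a connected space.
    rw [← Set.range_eq_univ]
    exact IsClopen.eq_univ ⟨hproper.isClosedMap.isClosed_range, hopen.isOpen_range⟩
      (Set.range_nonempty _)
  let e : (Xu × Xn → ℝ) ≃ₜ (Xu × Xn → ℝ) :=
    (Equiv.ofBijective _ ⟨aroeMap_injective hR0 hQ0 hirr x₀, hsurj⟩).toHomeomorphOfContinuousOpen
      hsm.continuous hopen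
  exact ⟨e.symm, e.contDiff_symm (f₀' := D) hD (contDiff_aroeMap hR0 hQ0 x₀),
    fun w => e.apply_symm_apply w⟩

end OptimalityEquation

end KLMDP

namespace KLMDP

/-! ### The invariant law and its smooth dependence on the kernel. -/

section InvariantLaw

theorem sum_vecMul {X : Type*} [Fintype X] {P : Matrix X X ℝ} (hP : IsStochastic P)
    (ρ : X → ℝ) :
    ∑ x, (Matrix.vecMul ρ P) x = ∑ x, ρ x := by
  simp only [Matrix.vecMul, dotProduct]
  rw [Finset.sum_comm]
  simp only [← Finset.mul_sum, (hP _).2, mul_one]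

variable {X : Type*} [Fintype X] [DecidableEq X] {P : Matrix X X ℝ}

/-- The fundamental matrix `1 - P + 𝟙𝟙ᵀ`; the invariant law `π` of an irreducible `P` is the only
row vector with `π (1 - P + 𝟙𝟙ᵀ) = 𝟙ᵀ`. -/
noncomputable def fundamentalMatrix (P : Matrix X X ℝ) : Matrix X X ℝ :=
  1 - P + Matrix.of fun _ _ => 1

/-- Cramer's formula for the invariant law. -/
noncomputable def invariantLaw (P : Matrix X X ℝ) (x : X) : ℝ :=
  (fundamentalMatrix P).transpose.det⁻¹ * (fundamentalMatrix P).transpose.cramer 1 x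

theorem fundamentalMatrix_mulVec (P : Matrix X X ℝ) (g : X → ℝ) (x : X) :
    ((fundamentalMatrix P).mulVec g) x = g x - (P.mulVec g) x + ∑ y, g y := by
  rw [fundamentalMatrix, Matrix.add_mulVec, Matrix.sub_mulVec, Matrix.one_mulVec]
  simp [Matrix.mulVec, dotProduct]

theorem vecMul_fundamentalMatrix (P : Matrix X X ℝ) (ρ : X → ℝ) (x : X) :
    (Matrix.vecMul ρ (fundamentalMatrix P)) x = ρ x - (Matrix.vecMul ρ P) x + ∑ y, ρ y := by
  rw [fundamentalMatrix, Matrix.vecMul_add, Matrix.vecMul_sub, Matrix.vecMul_one]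
  simp [Matrix.vecMul, dotProduct]

/-- A kernel vector g satisfies Pg - g = ∑ g, so by Poisson's equation it is constant with zero sum.
-/
theorem det_fundamentalMatrix_ne_zero [Nonempty X] (hP : IsStochastic P)
    (hirr : ∀ x y, ∃ n : ℕ, 0 < (P ^ n) x y) : (fundamentalMatrix P).det ≠ 0 := by
  rw [Ne, ← Matrix.exists_mulVec_eq_zero_iff]
  rintro ⟨g, hg0, hg⟩
  obtain ⟨hs, hc⟩ := hP.poisson_const hirr (g := g) (c := ∑ y, g y) fun x => by
    have := congrFun hg x
    rw [fundamentalMatrix_mulVec, Pi.zero_apply] at this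
    linarith
  refine hg0 (funext fun x => ?_)
  simp only [fun y => hc y x, Finset.sum_const, Finset.card_univ, nsmul_eq_mul] at hs
  exact (mul_eq_zero.1 hs).resolve_left (Nat.cast_ne_zero.2 Fintype.card_ne_zero)

theorem invariantLaw_spec [Nonempty X] (hP : IsStochastic P)
    (hirr : ∀ x y, ∃ n : ℕ, 0 < (P ^ n) x y) :
    invariantLaw P ∈ stdSimplex ℝ X ∧ Matrix.vecMul (invariantLaw P) P = invariantLaw P := by
  set π := invariantLaw P with hπ
  have hdet := det_fundamentalMatrix_ne_zero hP hirr
  have hM : ∀ x, π x - (Matrix.vecMul π P) x + ∑ y, π y = 1 := fun x => by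
    have h1 : π = (fundamentalMatrix P).transpose.det⁻¹ •
        (fundamentalMatrix P).transpose.cramer 1 := rfl
    rw [← vecMul_fundamentalMatrix, h1, ← Matrix.mulVec_transpose, Matrix.mulVec_smul,
      Matrix.mulVec_cramer, smul_smul, inv_mul_cancel₀ (by rwa [Matrix.det_transpose]), one_smul,
      Pi.one_apply]
  have hsum : ∑ y, π y = 1 := by
    have h1 := Finset.sum_congr (rfl : (Finset.univ : Finset X) = _) fun x _ => hM x
    simp only [Finset.sum_add_distrib, Finset.sum_sub_distrib, sum_vecMul hP, sub_self, zero_add,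
      Finset.sum_const, Finset.card_univ, nsmul_eq_mul] at h1
    exact mul_left_cancel₀ (Nat.cast_ne_zero.2 Fintype.card_ne_zero) h1
  have hinv : Matrix.vecMul π P = π := funext fun x => by
    have := hM x
    linarith
  -- Nonnegativity of π is not visible in Cramer's formula. The triangle inequality gives |π| ≤
  -- |π|P, and equal total masses force equality.
  have habs : Matrix.vecMul |π| P = |π| := by
    have hle : ∀ x, |π| x ≤ (Matrix.vecMul |π| P) x := fun x => by
      calc |π| x = |(Matrix.vecMul π P) x| := by rw [hinv, Pi.abs_apply]
        _ ≤ ∑ y, |π y * P y x| := Finset.abs_sum_le_sum_abs _ _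
        _ = (Matrix.vecMul |π| P) x := Finset.sum_congr rfl fun y _ => by
          rw [abs_mul, abs_of_nonneg ((hP y).1 x), Pi.abs_apply]
    have := (Finset.sum_eq_sum_iff_of_le fun x (_ : x ∈ Finset.univ) => hle x).1
      (sum_vecMul hP |π|).symm
    exact funext fun x => (this x (Finset.mem_univ x)).symm
  -- Both sides are invariant with the same total mass, so the invertible fundamental matrix sends
  -- them to the same vector.
  have hprop : |π| = (∑ y, |π| y) • π := by
    have hinj : Function.Injective (fun ρ => Matrix.vecMul ρ (fundamentalMatrix P)) :=
      Matrix.vecMul_injective_iff_isUnit.2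
        ((Matrix.isUnit_iff_isUnit_det _).2 hdet.isUnit)
    refine hinj (funext fun x => ?_)
    change (Matrix.vecMul _ _) x = (Matrix.vecMul _ _) x
    rw [vecMul_fundamentalMatrix, habs, Matrix.smul_vecMul, Pi.smul_apply,
      vecMul_fundamentalMatrix, hinv, hsum]
    simp
  refine ⟨⟨fun x => ?_, hsum⟩, hinv⟩
  have h1 := congrFun hprop x
  simp only [Pi.smul_apply, smul_eq_mul, Pi.abs_apply] at h1
  have h2 : 1 ≤ ∑ y, |π y| := hsum ▸ Finset.sum_le_sum fun y _ => le_abs_self (π y)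
  exact nonneg_of_mul_nonneg_right (h1 ▸ abs_nonneg (π x)) (by linarith)

theorem contDiff_det {E : Type*} [NormedAddCommGroup E] [NormedSpace ℝ E] {n : ℕ∞}
    {A : E → Matrix X X ℝ} (hA : ∀ x y, ContDiff ℝ n fun e => A e x y) :
    ContDiff ℝ n fun e => (A e).det := by
  simp only [Matrix.det_apply']
  exact ContDiff.sum fun σ _ => contDiff_const.mul (contDiff_prod fun x _ => hA (σ x) x)

/-- Cramer's formula is a quotient of polynomials in the entries of the kernel, with nonvanishing
denominator. -/
theorem contDiff_invariantLaw [Nonempty X] {E : Type*} [NormedAddCommGroup E] [NormedSpace ℝ E]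
    {n : ℕ∞} {A : E → Matrix X X ℝ} (hA : ∀ x y, ContDiff ℝ n fun e => A e x y)
    (hst : ∀ e, IsStochastic (A e)) (hirr : ∀ e x y, ∃ n : ℕ, 0 < (A e ^ n) x y) (x : X) :
    ContDiff ℝ n fun e => invariantLaw (A e) x := by
  have hF : ∀ y z, ContDiff ℝ n fun e => (fundamentalMatrix (A e)).transpose y z := fun y z => by
    simp only [fundamentalMatrix, Matrix.transpose_apply, Matrix.add_apply, Matrix.sub_apply,
      Matrix.of_apply]
    exact (contDiff_const.sub (hA z y)).add contDiff_const
  unfold invariantLaw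
  refine ((contDiff_det hF).inv fun e => ?_).mul ?_
  · rw [Matrix.det_transpose]
    exact det_fundamentalMatrix_ne_zero (hst e) (hirr e)
  · simp only [Matrix.cramer_apply]
    refine contDiff_det fun y z => ?_
    simp only [Matrix.updateCol_apply]
    split_ifs
    · exact contDiff_const
    · exact hF y z

end InvariantLaw

end KLMDP

namespace KLMDP

section EReal

theorem coe_finset_sum_ereal {ι : Type*} (s : Finset ι) (f : ι → ℝ) :
    ((∑ i ∈ s, f i : ℝ) : EReal) = ∑ i ∈ s, (f i : EReal) :=
  map_sum (⟨⟨Real.toEReal, EReal.coe_zero⟩, EReal.coe_add⟩ : ℝ →+ EReal) f s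

end EReal

/-! ### Verification of the AROE and of the static optimization problem. -/

section Verification

variable {Xu Xn : Type*} [Fintype Xu] [Fintype Xn] {U : Xu × Xn → ℝ}
  {R0 : Xu × Xn → Xu → ℝ} {Q0 : Xu × Xn → Xn → ℝ} {ζ η : ℝ} {h : Xu × Xn → ℝ}

/-- Gibbs' inequality with test function h(x_u' | x), after eliminating the cumulant by the
optimality equation. `reward_tiltedRule` is the equality case. -/
theorem reward_le (hR0 : IsStochastic R0) (hQ0 : IsStochastic Q0)
    (hΛ : ∀ x, ζ * U x + cumulant R0 Q0 h x = h x + η) (x : Xu × Xn) {μ : Xu → ℝ}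
    (hμ : μ ∈ stdSimplex ℝ Xu) :
    reward U R0 Q0 ζ x μ ≤ ((h x + η - ∑ x', nextLaw Q0 x μ x' * h x' : ℝ) : EReal) := by
  have h1 := sum_mul_sub_log_le_relEntropy (nextLaw_mem_stdSimplex hQ0 x hμ)
    (nextLaw_mem_stdSimplex hQ0 x (hR0 x)) fun x' => condExpQ Q0 h x x'.1
  rw [sum_nextLaw_mul_condExpQ hQ0, ← cumulant_eq] at h1
  have h2 : h x + η - ∑ x', nextLaw Q0 x μ x' * h x' =
      ζ * U x - (∑ x', nextLaw Q0 x μ x' * h x' - cumulant R0 Q0 h x) := by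
    rw [← hΛ x]
    ring
  rw [h2, EReal.coe_sub]
  exact EReal.sub_le_sub le_rfl h1

theorem relEntropy_tiltedRule (hR0 : IsStochastic R0) (hQ0 : IsStochastic Q0) (x : Xu × Xn) :
    relEntropy (nextLaw Q0 x (tiltedRule R0 Q0 h x)) (nextLaw Q0 x (R0 x)) =
      ((∑ x', nextLaw Q0 x (tiltedRule R0 Q0 h x) x' * h x' - cumulant R0 Q0 h x : ℝ) :
        EReal) := by
  rw [relEntropy_tilt (nextLaw_mem_stdSimplex hQ0 x (hR0 x)) (fun x' => condExpQ Q0 h x x'.1)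
    (nextLaw_tiltedRule h x), sum_nextLaw_mul_condExpQ hQ0, ← cumulant_eq]

theorem reward_tiltedRule (hR0 : IsStochastic R0) (hQ0 : IsStochastic Q0)
    (hΛ : ∀ x, ζ * U x + cumulant R0 Q0 h x = h x + η) (x : Xu × Xn) :
    reward U R0 Q0 ζ x (tiltedRule R0 Q0 h x) =
      ((h x + η - ∑ x', nextLaw Q0 x (tiltedRule R0 Q0 h x) x' * h x' : ℝ) : EReal) := by
  have h2 : h x + η - ∑ x', nextLaw Q0 x (tiltedRule R0 Q0 h x) x' * h x' =
      ζ * U x - (∑ x', nextLaw Q0 x (tiltedRule R0 Q0 h x) x' * h x' - cumulant R0 Q0 h x) := by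
    rw [← hΛ x]
    ring
  rw [h2, EReal.coe_sub, ← relEntropy_tiltedRule hR0 hQ0]
  rfl

theorem bellman_tiltedRule (hR0 : IsStochastic R0) (hQ0 : IsStochastic Q0)
    (hΛ : ∀ x, ζ * U x + cumulant R0 Q0 h x = h x + η) (x : Xu × Xn) :
    bellman U R0 Q0 ζ h x (tiltedRule R0 Q0 h) = ((h x + η : ℝ) : EReal) := by
  rw [bellman, reward_tiltedRule hR0 hQ0 hΛ, ← EReal.coe_add]
  congr 1
  exact sub_add_cancel _ _

theorem isAROESolution_of_cumulant (hR0 : IsStochastic R0) (hQ0 : IsStochastic Q0)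
    (hΛ : ∀ x, ζ * U x + cumulant R0 Q0 h x = h x + η) : IsAROESolution U R0 Q0 ζ h η := by
  refine fun x => ⟨⟨tiltedRule R0 Q0 h, isStochastic_tiltedRule hR0 hQ0 h,
    bellman_tiltedRule hR0 hQ0 hΛ x⟩, ?_⟩
  rintro _ ⟨R, hR, rfl⟩
  refine (add_le_add (reward_le hR0 hQ0 hΛ x (hR x)) le_rfl).trans (le_of_eq ?_)
  rw [← EReal.coe_add]
  congr 1
  exact sub_add_cancel _ _

theorem sum_mul_mulVec_of_invariant {X : Type*} [Fintype X] {P : Matrix X X ℝ} {π : X → ℝ}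
    (hinv : Matrix.vecMul π P = π) (f : X → ℝ) :
    ∑ x, π x * ∑ x', P x x' * f x' = ∑ x, π x * f x := by
  change π ⬝ᵥ P.mulVec f = π ⬝ᵥ f
  rw [Matrix.dotProduct_mulVec, hinv]

/-- Averaging the optimality equation over an invariant law cancels h, whatever P is. Replacing the
entropy by its Gibbs lower bound therefore makes the objective constant, equal to η. -/
theorem sum_invariant_cumulant {π : Xu × Xn → ℝ} {P : Matrix (Xu × Xn) (Xu × Xn) ℝ}
    (hΛ : ∀ x, ζ * U x + cumulant R0 Q0 h x = h x + η) (hπ : ∑ x, π x = 1)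
    (hinv : Matrix.vecMul π P = π) :
    ζ * ∑ x, π x * U x - ∑ x, π x * (∑ x', P x x' * h x' - cumulant R0 Q0 h x) = η := by
  simp only [mul_sub, Finset.sum_sub_distrib]
  rw [sum_mul_mulVec_of_invariant hinv, Finset.mul_sum, ← Finset.sum_sub_distrib,
    ← Finset.sum_sub_distrib, ← one_mul η, ← hπ, Finset.sum_mul]
  refine Finset.sum_congr rfl fun x _ => ?_
  linear_combination π x * hΛ x

theorem objective_le (hR0 : IsStochastic R0) (hQ0 : IsStochastic Q0)
    (hΛ : ∀ x, ζ * U x + cumulant R0 Q0 h x = h x + η)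
    {q : (Xu × Xn → ℝ) × Matrix (Xu × Xn) (Xu × Xn) ℝ} (hq : q ∈ feasible Q0) :
    objective U R0 Q0 ζ q ≤ (η : EReal) := by
  obtain ⟨π, P⟩ := q
  obtain ⟨hπ, ⟨R, hR, hP⟩, hinv⟩ := hq
  dsimp only at hπ hP hinv
  rw [← sum_invariant_cumulant hΛ hπ.2 hinv, EReal.coe_sub]
  refine EReal.sub_le_sub le_rfl ?_
  rw [coe_finset_sum_ereal]
  refine Finset.sum_le_sum fun x _ => ?_
  rw [EReal.coe_mul]
  refine mul_le_mul_of_nonneg_left ?_ (EReal.coe_nonneg.2 (hπ.1 x))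
  have h1 := sum_mul_sub_log_le_relEntropy (nextLaw_mem_stdSimplex hQ0 x (hR x))
    (nextLaw_mem_stdSimplex hQ0 x (hR0 x)) fun x' => condExpQ Q0 h x x'.1
  rw [sum_nextLaw_mul_condExpQ hQ0, ← cumulant_eq] at h1
  rw [hP]
  exact h1

theorem objective_tiltedRule (hR0 : IsStochastic R0) (hQ0 : IsStochastic Q0)
    (hΛ : ∀ x, ζ * U x + cumulant R0 Q0 h x = h x + η) {π : Xu × Xn → ℝ} (hπ : ∑ x, π x = 1)
    (hinv : Matrix.vecMul π (transMat Q0 (tiltedRule R0 Q0 h)) = π) :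
    objective U R0 Q0 ζ (π, transMat Q0 (tiltedRule R0 Q0 h)) = (η : EReal) := by
  rw [← sum_invariant_cumulant hΛ hπ hinv, EReal.coe_sub, objective]
  congr 1
  rw [coe_finset_sum_ereal]
  refine Finset.sum_congr rfl fun x _ => ?_
  rw [EReal.coe_mul]
  congr 1
  exact relEntropy_tiltedRule hR0 hQ0 x

end Verification

/-! ### Average reward of history-dependent policies. -/

section Policies

variable {Xu Xn : Type*} [Fintype Xu] [Fintype Xn] {U : Xu × Xn → ℝ}
  {R0 : Xu × Xn → Xu → ℝ} {Q0 : Xu × Xn → Xn → ℝ} {ζ η : ℝ} {h : Xu × Xn → ℝ}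

variable (Q0) in
/-- The expectation `E_x[f(X(t))]` under the policy `φ`. -/
noncomputable def expectedValue (φ : Policy Xu Xn) (x : Xu × Xn) (f : Xu × Xn → ℝ) (t : ℕ) : ℝ :=
  ∑ s : Fin (t + 1) → Xu × Xn, historyProb Q0 φ x t s * f (s (Fin.last t))

theorem historyProb_nonneg (hQ0 : IsStochastic Q0) (φ : Policy Xu Xn) (x : Xu × Xn) (t : ℕ)
    (s : Fin (t + 1) → Xu × Xn) : 0 ≤ historyProb Q0 φ x t s := by
  induction t with
  | zero =>
    rw [historyProb]
    split_ifs <;> norm_num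
  | succ t ih =>
    rw [historyProb]
    exact mul_nonneg (ih _) ((nextLaw_mem_stdSimplex hQ0 _ (φ.isPmf _ _)).1 _)

theorem expectedValue_zero (φ : Policy Xu Xn) (x : Xu × Xn) (f : Xu × Xn → ℝ) :
    expectedValue Q0 φ x f 0 = f x := by
  classical
  rw [expectedValue, ← (Equiv.funUnique (Fin 1) (Xu × Xn)).symm.sum_comp]
  simp [historyProb]

theorem expectedValue_succ (φ : Policy Xu Xn) (x : Xu × Xn) (f : Xu × Xn → ℝ) (t : ℕ) :
    expectedValue Q0 φ x f (t + 1) = ∑ s : Fin (t + 1) → Xu × Xn, historyProb Q0 φ x t s *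
      ∑ x', nextLaw Q0 (s (Fin.last t)) (φ.rule t s) x' * f x' := by
  -- A history up to t + 1 is split into the history up to t and the last state.
  rw [expectedValue, ← (Fin.snocEquiv fun _ => Xu × Xn).sum_comp, Fintype.sum_prod_type,
    Finset.sum_comm]
  refine Finset.sum_congr rfl fun s _ => ?_
  rw [Finset.mul_sum]
  refine Finset.sum_congr rfl fun x' _ => ?_
  simp [historyProb, Fin.snocEquiv, mul_assoc]

theorem expectedValue_const (hQ0 : IsStochastic Q0) (φ : Policy Xu Xn) (x : Xu × Xn) (c : ℝ)
    (t : ℕ) : expectedValue Q0 φ x (fun _ => c) t = c := by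
  induction t with
  | zero => rw [expectedValue_zero]
  | succ t ih =>
    rw [expectedValue_succ]
    simp only [← Finset.sum_mul, (nextLaw_mem_stdSimplex hQ0 _ (φ.isPmf _ _)).2, one_mul]
    rw [Finset.sum_mul]
    exact ih

theorem abs_expectedValue_le (hQ0 : IsStochastic Q0) (φ : Policy Xu Xn) (x : Xu × Xn)
    (f : Xu × Xn → ℝ) (t : ℕ) : |expectedValue Q0 φ x f t| ≤ ‖f‖ := by
  calc |expectedValue Q0 φ x f t| ≤ expectedValue Q0 φ x (fun _ => ‖f‖) t :=
        (Finset.abs_sum_le_sum_abs _ _).trans <| Finset.sum_le_sum fun s _ => by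
          rw [abs_mul, abs_of_nonneg (historyProb_nonneg hQ0 φ x t s)]
          exact mul_le_mul_of_nonneg_left (norm_le_pi_norm f _) (historyProb_nonneg hQ0 φ x t s)
    _ = ‖f‖ := expectedValue_const hQ0 φ x _ t

/-- Puts the one-step bound of `reward_le`, averaged over histories, in a form that telescopes in t.
-/
theorem sum_historyProb_mul_drift (hQ0 : IsStochastic Q0) (φ : Policy Xu Xn) (x : Xu × Xn)
    (t : ℕ) :
    ((expectedValue Q0 φ x h t + η - expectedValue Q0 φ x h (t + 1) : ℝ) : EReal) =
      ∑ s : Fin (t + 1) → Xu × Xn, (historyProb Q0 φ x t s : EReal) *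
        ((h (s (Fin.last t)) + η -
          ∑ x', nextLaw Q0 (s (Fin.last t)) (φ.rule t s) x' * h x' : ℝ) : EReal) := by
  simp only [← EReal.coe_mul]
  rw [← coe_finset_sum_ereal]
  congr 1
  nth_rewrite 1 [← expectedValue_const hQ0 φ x η t]
  rw [expectedValue_succ, expectedValue, expectedValue, ← Finset.sum_add_distrib,
    ← Finset.sum_sub_distrib]
  refine Finset.sum_congr rfl fun s _ => ?_
  ring

theorem expReward_le (hR0 : IsStochastic R0) (hQ0 : IsStochastic Q0)
    (hΛ : ∀ x, ζ * U x + cumulant R0 Q0 h x = h x + η) (φ : Policy Xu Xn) (x : Xu × Xn) (t : ℕ) :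
    expReward U R0 Q0 ζ φ x t ≤
      ((expectedValue Q0 φ x h t + η - expectedValue Q0 φ x h (t + 1) : ℝ) : EReal) := by
  rw [sum_historyProb_mul_drift hQ0]
  exact Finset.sum_le_sum fun s _ => mul_le_mul_of_nonneg_left
    (reward_le hR0 hQ0 hΛ _ (φ.isPmf t s)) (EReal.coe_nonneg.2 (historyProb_nonneg hQ0 φ x t s))

theorem expReward_stationary_tiltedRule (hR0 : IsStochastic R0) (hQ0 : IsStochastic Q0)
    (hΛ : ∀ x, ζ * U x + cumulant R0 Q0 h x = h x + η)
    (hR : IsStochastic (tiltedRule R0 Q0 h)) (x : Xu × Xn) (t : ℕ) :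
    expReward U R0 Q0 ζ (stationary _ hR) x t =
      ((expectedValue Q0 (stationary _ hR) x h t + η -
        expectedValue Q0 (stationary _ hR) x h (t + 1) : ℝ) : EReal) := by
  rw [sum_historyProb_mul_drift hQ0]
  exact Finset.sum_congr rfl fun s _ => congrArg _ (reward_tiltedRule hR0 hQ0 hΛ _)

theorem sum_drift (φ : Policy Xu Xn) (x : Xu × Xn) (T : ℕ) :
    ∑ t ∈ Finset.range T, (expectedValue Q0 φ x h t + η - expectedValue Q0 φ x h (t + 1)) =
      h x - expectedValue Q0 φ x h T + T * η := by
  have := Finset.sum_range_sub' (expectedValue Q0 φ x h) T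
  rw [expectedValue_zero] at this
  simp only [add_sub_right_comm, Finset.sum_add_distrib, this, Finset.sum_const,
    Finset.card_range, nsmul_eq_mul]

theorem liminf_average_drift (hQ0 : IsStochastic Q0) (φ : Policy Xu Xn) (x : Xu × Xn) :
    Filter.liminf (fun T : ℕ => (∑ t ∈ Finset.range T, ((expectedValue Q0 φ x h t + η -
      expectedValue Q0 φ x h (t + 1) : ℝ) : EReal)) / ((T : ℝ) : EReal)) Filter.atTop =
      (η : EReal) := by
  refine Filter.Tendsto.liminf_eq ?_
  simp only [← coe_finset_sum_ereal, ← EReal.coe_div, sum_drift]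
  refine (continuous_coe_real_ereal.tendsto η).comp ?_
  have h1 : Filter.Tendsto (fun T : ℕ => (h x - expectedValue Q0 φ x h T) / (T : ℝ))
      Filter.atTop (nhds 0) := by
    -- The telescoped remainder h(x) - E_x[h(X(T))] is at most 2‖h‖ in absolute value, uniformly in
    -- T.
    refine squeeze_zero_norm (a := fun T : ℕ => (2 * ‖h‖) / (T : ℝ)) (fun T => ?_)
      (tendsto_const_div_atTop_nhds_zero_nat _)
    rw [norm_div, Real.norm_natCast]
    gcongr
    rw [two_mul]
    exact (norm_sub_le _ _).trans
      (add_le_add (norm_le_pi_norm h x) (abs_expectedValue_le hQ0 φ x h T))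
  have h2 := h1.add_const η
  rw [zero_add] at h2
  refine h2.congr' ?_
  filter_upwards [Filter.eventually_gt_atTop 0] with T hT
  have : (T : ℝ) ≠ 0 := by positivity
  field_simp

theorem avgReward_le (hR0 : IsStochastic R0) (hQ0 : IsStochastic Q0)
    (hΛ : ∀ x, ζ * U x + cumulant R0 Q0 h x = h x + η) (φ : Policy Xu Xn) (x : Xu × Xn) :
    avgReward U R0 Q0 ζ φ x ≤ (η : EReal) := by
  rw [← liminf_average_drift (h := h) hQ0 φ x]
  exact Filter.liminf_le_liminf (Filter.Eventually.of_forall fun T =>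
    EReal.div_le_div_right_of_nonneg (EReal.coe_nonneg.2 T.cast_nonneg)
      (Finset.sum_le_sum fun t _ => expReward_le hR0 hQ0 hΛ φ x t))

theorem avgReward_stationary_tiltedRule (hR0 : IsStochastic R0) (hQ0 : IsStochastic Q0)
    (hΛ : ∀ x, ζ * U x + cumulant R0 Q0 h x = h x + η)
    (hR : IsStochastic (tiltedRule R0 Q0 h)) (x : Xu × Xn) :
    avgReward U R0 Q0 ζ (stationary _ hR) x = (η : EReal) := by
  rw [← liminf_average_drift (h := h) hQ0 (stationary _ hR) x]
  simp only [avgReward, expReward_stationary_tiltedRule hR0 hQ0 hΛ]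

end Policies

end KLMDP

/-! ### The optimal solution as a function of ζ. -/

theorem theoremt {Xu Xn : Type*} [Fintype Xu] [Fintype Xn] [DecidableEq Xu] [DecidableEq Xn]
    (U : Xu × Xn → ℝ) (R0 : Xu × Xn → Xu → ℝ) (Q0 : Xu × Xn → Xn → ℝ)
    (hR0 : KLMDP.IsStochastic R0) (hQ0 : KLMDP.IsStochastic Q0)
    (hirr : (KLMDP.transMat Q0 R0).IsIrreducible)
    (haper : KLMDP.IsAperiodic (KLMDP.transMat Q0 R0))
    (x₀ : Xu × Xn) :
    ∃ (π : ℝ → Xu × Xn → ℝ) (P : ℝ → Matrix (Xu × Xn) (Xu × Xn) ℝ)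
      (h : ℝ → Xu × Xn → ℝ) (η : ℝ → ℝ),
      -- `(π ζ, P ζ)` is an optimizer, with optimal value `η ζ`
      (∀ ζ, KLMDP.IsOptimizer U R0 Q0 ζ (π ζ) (P ζ) ∧
        KLMDP.objective U R0 Q0 ζ (π ζ, P ζ) = (η ζ : EReal)) ∧
      -- `(h ζ, η ζ)` solves the AROE, normalized at `x₀`
      (∀ ζ, KLMDP.IsAROESolution U R0 Q0 ζ (h ζ) (η ζ) ∧ h ζ x₀ = 0) ∧
      -- `η ζ` is the optimal average reward, from every initial state
      (∀ ζ x, IsGreatest (Set.range fun φ : KLMDP.Policy Xu Xn =>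
        KLMDP.avgReward U R0 Q0 ζ φ x) (η ζ : EReal)) ∧
      -- `P ζ` is defined by a maximizer in the AROE, which is an optimal stationary policy
      (∀ ζ, ∃ (R : Xu × Xn → Xu → ℝ) (hR : KLMDP.IsStochastic R),
        P ζ = KLMDP.transMat Q0 R ∧
        (∀ x, KLMDP.bellman U R0 Q0 ζ (h ζ) x R = ((h ζ x + η ζ : ℝ) : EReal)) ∧
        (∀ x, KLMDP.avgReward U R0 Q0 ζ (KLMDP.stationary R hR) x = (η ζ : EReal))) ∧
      -- (i) the exponential tilt
      (∀ ζ x x', P ζ x x' = KLMDP.transMat Q0 R0 x x' *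
        Real.exp (KLMDP.condExpQ Q0 (h ζ) x x'.1 -
          KLMDP.logMGF (KLMDP.transMat Q0 R0)
            (fun y y' => KLMDP.condExpQ Q0 (h ζ) y y'.1) x)) ∧
      -- (ii) continuous differentiability in `ζ`
      (∀ x, ContDiff ℝ 1 fun ζ => π ζ x) ∧
      (∀ x x', ContDiff ℝ 1 fun ζ => P ζ x x') ∧
      (∀ x, ContDiff ℝ 1 fun ζ => h ζ x) ∧
      ContDiff ℝ 1 η := by
  have : Nonempty (Xu × Xn) := ⟨x₀⟩
  have hpos : ∀ x y, ∃ n : ℕ, 0 < (KLMDP.transMat Q0 R0 ^ n) x y := fun x y => by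
    obtain ⟨n, -, hn⟩ := (Matrix.isIrreducible_iff_exists_pow_pos hirr.nonneg).1 hirr x y
    exact ⟨n, hn⟩
  obtain ⟨V, hV, hVU⟩ := KLMDP.exists_contDiff_rightInverse_aroeMap hR0 hQ0 hpos x₀ (n := 1)
  set v : ℝ → Xu × Xn → ℝ := fun ζ => V (ζ • U) with hv
  have hvs : ContDiff ℝ 1 v := hV.comp (contDiff_id.smul contDiff_const)
  have hvx : ∀ x, ContDiff ℝ 1 fun ζ => v ζ x := contDiff_pi.1 hvs
  -- Unmerging v = h + η under h(x₀) = 0 gives η = v(x₀) and h = v - v(x₀).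
  set h : ℝ → Xu × Xn → ℝ := fun ζ x => v ζ x - v ζ x₀ with hh
  set P : ℝ → Matrix (Xu × Xn) (Xu × Xn) ℝ := fun ζ =>
    KLMDP.transMat Q0 (KLMDP.tiltedRule R0 Q0 (h ζ)) with hP
  have hhx : ∀ x, ContDiff ℝ 1 fun ζ => h ζ x := fun x => (hvx x).sub (hvx x₀)
  have hPx : ∀ x x', ContDiff ℝ 1 fun ζ => P ζ x x' := fun x x' =>
    (KLMDP.contDiff_transMat_tiltedRule hR0 hQ0 (n := 1) x x').comp (contDiff_pi.2 hhx)
  have hΛ : ∀ ζ x, ζ * U x + KLMDP.cumulant R0 Q0 (h ζ) x = h ζ x + v ζ x₀ := fun ζ x => by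
    have h1 := congrFun (hVU (ζ • U)) x
    have h2 := KLMDP.cumulant_add_const hR0 hQ0 (v ζ) (-v ζ x₀) x
    simp only [← sub_eq_add_neg] at h2
    simp only [KLMDP.aroeMap, Pi.smul_apply, smul_eq_mul] at h1
    simp only [hh]
    linarith
  have hR := fun ζ => KLMDP.isStochastic_tiltedRule hR0 hQ0 (h ζ)
  have hPst := fun ζ => hQ0.transMat (hR ζ)
  have hPpos := fun ζ => KLMDP.exists_pow_transMat_tiltedRule_pos hR0 hQ0 hpos (h ζ)
  have hπ := fun ζ => KLMDP.invariantLaw_spec (hPst ζ) (hPpos ζ)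
  have hobj := fun ζ => KLMDP.objective_tiltedRule hR0 hQ0 (hΛ ζ) (hπ ζ).1.2 (hπ ζ).2
  refine ⟨fun ζ => KLMDP.invariantLaw (P ζ), P, h, fun ζ => v ζ x₀, fun ζ => ⟨⟨⟨(hπ ζ).1,
    ⟨_, hR ζ, rfl⟩, (hπ ζ).2⟩, fun q hq => (KLMDP.objective_le hR0 hQ0 (hΛ ζ) hq).trans
    (hobj ζ).ge⟩, hobj ζ⟩, fun ζ => ⟨KLMDP.isAROESolution_of_cumulant hR0 hQ0 (hΛ ζ),
    sub_self _⟩, fun ζ x => ⟨⟨KLMDP.stationary _ (hR ζ),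
    KLMDP.avgReward_stationary_tiltedRule hR0 hQ0 (hΛ ζ) (hR ζ) x⟩, ?_⟩, fun ζ => ⟨_, hR ζ, rfl,
    KLMDP.bellman_tiltedRule hR0 hQ0 (hΛ ζ),
    KLMDP.avgReward_stationary_tiltedRule hR0 hQ0 (hΛ ζ) (hR ζ)⟩,
    fun ζ x x' => KLMDP.nextLaw_tiltedRule (h ζ) x x',
    KLMDP.contDiff_invariantLaw (n := 1) hPx hPst hPpos, hPx, hhx, hvx x₀⟩
  rintro _ ⟨φ, rfl⟩
  exact KLMDP.avgReward_le hR0 hQ0 (hΛ ζ) φ x
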